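/- Let $d\ge 1$. For real $r>0$ let $B[r]=\{y\in\mathbb{Z}^d:|y|\le r\}$, where $|\cdot|$ is the Euclidean norm, and let $b_r=|B[r]|$ be the number of its points. For $A\subset\mathbb{Z}^d$ let $\partial A$ be the set of vertices of $\mathbb{Z}^d\setminus A$ that have at least one nearest neighbour in $A$. Let $\mathbb{P}_x$ be the law of the simple random walk $\xi=(\xi(0),\xi(1),\dots)$ on $\mathbb{Z}^d$ with $\xi(0)=x$. We say that $\xi$ exits $A$ through $T$ if there is a first time $t\ge 0$ with $\xi(t)\notin A$ and $\xi(t)\in T$ at this time. **Lemma.** For every $p>0$ there exist $\varepsilon>0$ and $N\ge 1$ (depending only on $p$ and $d$) such that for all real $n,m\ge N$, all $x\in B[m]$ and all $S\subseteq B[m+n]$ with $|S|\le\varepsilon b_n$, $$\mathbb{P}_x\Big(\xi\text{ exits }S\cup B[m]\text{ through }\partial B[m+n]\Big)\le p .$$ -/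

import Mathlib

open MeasureTheory

namespace ExitProb

/-- The Euclidean ball `B[r] = {y ∈ ℤ^d : |y| ≤ r}`. -/
def ball (d : ℕ) (r : ℝ) : Set (Fin d → ℤ) :=
  {y | ‖WithLp.toLp 2 (fun i => (y i : ℝ))‖ ≤ r}

theorem ball_finite (d : ℕ) (r : ℝ) : (ball d r).Finite := by
  refine (Set.Finite.pi' (fun _ : Fin d => Set.finite_Icc (-⌈r⌉) ⌈r⌉)).subset ?_
  intro y hy i
  have h1 : |(y i : ℝ)| ≤ r :=
    le_trans (PiLp.norm_apply_le (p := 2) (WithLp.toLp 2 (fun i => (y i : ℝ))) i) hy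
  have h2 : |(y i : ℝ)| ≤ (⌈r⌉ : ℤ) := h1.trans (Int.le_ceil r)
  have h3 : |y i| ≤ ⌈r⌉ := by exact_mod_cast h2
  exact abs_le.mp h3

/-- The volume `b_r = |B[r]|`. -/
noncomputable def ballCard (d : ℕ) (r : ℝ) : ℕ := (ball d r).ncard

/-- The `2d` unit vectors `±e_i`, indexed by `Fin d × Bool`. -/
def unitStep {d : ℕ} (e : Fin d × Bool) : Fin d → ℤ :=
  if e.2 then Pi.single e.1 1 else -Pi.single e.1 1

/-- The outer boundary of `A`: the vertices outside `A` with a neighbour in `A`. -/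
def boundary {d : ℕ} (A : Set (Fin d → ℤ)) : Set (Fin d → ℤ) :=
  {z | z ∉ A ∧ ∃ e : Fin d × Bool, z + unitStep e ∈ A}

/-- The trajectory started at `x` whose successive increments are the `±e_i` listed by `ω`. -/
def path {d : ℕ} (x : Fin d → ℤ) (ω : ℕ → Fin d × Bool) (t : ℕ) : Fin d → ℤ :=
  x + ∑ k ∈ Finset.range t, unitStep (ω k)

theorem measurable_path {d : ℕ} (x : Fin d → ℤ) : Measurable (path x) := by
  refine measurable_pi_lambda _ fun t => ?_
  unfold path
  refine measurable_const.add (Finset.measurable_sum _ fun k _ => ?_)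
  exact (measurable_of_finite unitStep).comp (measurable_pi_apply k)

/-- The law `ℙ_x` on trajectories of the simple random walk on `ℤ^d` started at `x`:
the increments are independent and uniform on the `2d` unit vectors. -/
noncomputable def srwLaw {d : ℕ} [NeZero d] (x : Fin d → ℤ) : Measure (ℕ → Fin d → ℤ) :=
  (Measure.infinitePi fun _ : ℕ => (PMF.uniformOfFintype (Fin d × Bool)).toMeasure).map (path x)

instance {d : ℕ} [NeZero d] (x : Fin d → ℤ) : IsProbabilityMeasure (srwLaw x) :=
  Measure.isProbabilityMeasure_map (measurable_path x).aemeasurable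

/-- The event that the trajectory exits `A` through `T`: there is a first time at which it is not
in `A`, and its position at that time belongs to `T`. -/
def exitsThrough {d : ℕ} (A T : Set (Fin d → ℤ)) : Set (ℕ → Fin d → ℤ) :=
  {ξ | ∃ t : ℕ, IsLeast {s | ξ s ∉ A} t ∧ ξ t ∈ T}

end ExitProb

/-!
Let `A = S ∪ B[m]`. A walk from `B[m]` that exits `A` through the boundary of `B[m + n]` must cross
the shell `m + n / 2 ≤ |z| ≤ m + n / 2 + 1`, so by a maximum principle
(`srwLaw_real_exitsBy_le_of_shell`) it is enough to bound the exit probability from the points `z`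
of this shell. Around such a `z` the ball of radius `R = n / 2 - 1` misses `B[m]` and the boundary
of `B[m + n]`. Hence, whatever `t` is, a walk from `z` that exits `A` through this boundary either
leaves that ball by time `t`, or is still inside `A`, and so in `S`, at time `t`
(`srwLaw_real_exitsBy_le`).

The first event has probability at most `t / R²`, because `|ξ(s) - z|² - s` is a martingale. The
second has probability at most `|S|` times the maximum of the heat kernel at time `t`, that is
`O(|S| t^(-d/2))` (`heatKernel_le`). With `t` a small multiple of `n²`, and then `|S|` at most a
small multiple of `n^d`, both are at most `p / 2`.

The heat kernel is defined as a Fourier integral over the torus, and the only properties needed are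
its initial value, its recursion in time, and the bound
`|(1 / d) ∑ cos θᵢ| ≤ exp (-(1 / (2d)) ∑ sin² θᵢ)`, which turns the integral into a product of
Gaussian-type integrals. The right-hand side is periodic with period `π`, so that the parity of the
walk needs no separate treatment.

The law of the walk enters only through the probabilities of exiting `A` through `T` by time `K`,
and these only through the one-step Markov property (`srwLaw_real_exitsBy_succ_le`), which reflects
that an infinite product measure is invariant under adjoining one more factor in front
(`map_cons_prod_infinitePi`).
-/

namespace ExitProb

/-! ### The Markov property of the walk -/

/-- The sequence `e, ω 0, ω 1, …`. -/
def cons {α : Type*} (q : α × (ℕ → α)) : ℕ → α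
  | 0 => q.1
  | k + 1 => q.2 k

theorem measurable_cons {α : Type*} [MeasurableSpace α] :
    Measurable (cons : α × (ℕ → α) → ℕ → α) := by
  refine measurable_pi_lambda _ fun k => ?_
  cases k with
  | zero => exact measurable_fst
  | succ k => exact (measurable_pi_apply k).comp measurable_snd

theorem map_cons_prod_infinitePi {α : Type*} [MeasurableSpace α] (ν : Measure α)
    [IsProbabilityMeasure ν] :
    (ν.prod (Measure.infinitePi fun _ : ℕ => ν)).map cons = Measure.infinitePi fun _ : ℕ => ν := by
  classical
  refine Measure.eq_infinitePi _ fun s t ht => ?_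
  -- Enlarge the finite index set `s` to an initial segment, with `univ` at the new indices.
  obtain ⟨N, hN⟩ : ∃ N, s ⊆ Finset.range (N + 1) :=
    ⟨s.sup id, fun i hi => Finset.mem_range.2 (Nat.lt_succ_of_le (Finset.le_sup (f := id) hi))⟩
  set t' : ℕ → Set α := fun i => if i ∈ s then t i else Set.univ with ht'
  have hm : ∀ i, MeasurableSet (t' i) := fun i => by
    simp only [ht']; split_ifs
    exacts [ht i, MeasurableSet.univ]
  have h1 : Set.pi s t = Set.pi (Finset.range (N + 1)) t' := by
    ext ω
    simp only [Set.mem_pi, Finset.mem_coe, ht']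
    constructor
    · intro h i _
      split_ifs with his
      exacts [h i his, Set.mem_univ _]
    · intro h i hi
      simpa [hi] using h i (hN hi)
  have h2 : ∏ i ∈ s, ν (t i) = ∏ i ∈ Finset.range (N + 1), ν (t' i) := by
    rw [← Finset.prod_subset hN]
    · exact Finset.prod_congr rfl fun i hi => by simp [ht', hi]
    · intro i _ hi
      simp [ht', hi]
  have h3 : cons ⁻¹' Set.pi (Finset.range (N + 1) : Finset ℕ) t' =
      t' 0 ×ˢ Set.pi (Finset.range N : Finset ℕ) fun i => t' (i + 1) := by
    ext ⟨e, ω⟩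
    simp only [Set.mem_preimage, Set.mem_pi, Finset.mem_coe, Finset.mem_range, Set.mem_prod]
    constructor
    · exact fun h => ⟨h 0 (Nat.succ_pos _), fun i hi => h (i + 1) (Nat.succ_lt_succ hi)⟩
    · rintro ⟨h, h'⟩ (_ | i) hi
      exacts [h, h' i (Nat.lt_of_succ_lt_succ hi)]
  rw [h1, h2, Measure.map_apply measurable_cons
    (MeasurableSet.pi (Finset.countable_toSet _) fun i _ => hm i), h3, Measure.prod_prod,
    Measure.infinitePi_pi _ fun i _ => hm (i + 1), Finset.prod_range_succ', mul_comm]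

variable {d : ℕ}

theorem path_cons_succ (x : Fin d → ℤ) (e : Fin d × Bool) (ω : ℕ → Fin d × Bool) (t : ℕ) :
    path x (cons (e, ω)) (t + 1) = path (x + unitStep e) ω t := by
  simp only [path, Finset.sum_range_succ', cons]
  abel

/-- The one-step Markov property: the shifted trajectory is a walk from a uniform neighbour. -/
theorem srwLaw_real_preimage_shift [NeZero d] (x : Fin d → ℤ) {E : Set (ℕ → Fin d → ℤ)}
    (hE : MeasurableSet E) :
    (srwLaw x).real {ξ | (fun t => ξ (t + 1)) ∈ E} =
      (∑ e : Fin d × Bool, (srwLaw (x + unitStep e)).real E) / (2 * d) := by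
  set ν := (PMF.uniformOfFintype (Fin d × Bool)).toMeasure
  have hs : Measurable fun ξ : ℕ → Fin d → ℤ => fun t => ξ (t + 1) :=
    measurable_pi_lambda _ fun t => measurable_pi_apply _
  have hE' : MeasurableSet {ξ : ℕ → Fin d → ℤ | (fun t => ξ (t + 1)) ∈ E} := hs hE
  have key : srwLaw x {ξ | (fun t => ξ (t + 1)) ∈ E} =
      ∑ e : Fin d × Bool, srwLaw (x + unitStep e) E * (2 * d : ENNReal)⁻¹ := by
    rw [srwLaw, Measure.map_apply (measurable_path x) hE', ← map_cons_prod_infinitePi,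
      Measure.map_apply measurable_cons (measurable_path x hE'),
      Measure.prod_apply (measurable_cons (measurable_path x hE')), lintegral_fintype]
    refine Finset.sum_congr rfl fun e _ => ?_
    congr 1
    · rw [srwLaw, Measure.map_apply (measurable_path _) hE]
      congr 1
      ext ω
      simp only [Set.mem_preimage, Set.mem_ofPred_eq, path_cons_succ]
    · rw [PMF.toMeasure_apply_singleton _ _ (measurableSet_singleton e)]
      simp [mul_comm]
  rw [measureReal_def, key, ENNReal.toReal_sum fun e _ => ENNReal.mul_ne_top
    (measure_ne_top _ _) (ENNReal.inv_ne_top.2 (by simp [NeZero.ne d])), Finset.sum_div]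
  refine Finset.sum_congr rfl fun e _ => ?_
  simp [measureReal_def, div_eq_mul_inv]

/-- The event that the trajectory exits `A` through `T` no later than time `K`. -/
def exitsBy (A T : Set (Fin d → ℤ)) (K : ℕ) : Set (ℕ → Fin d → ℤ) :=
  {ξ | ∃ t ≤ K, IsLeast {s | ξ s ∉ A} t ∧ ξ t ∈ T}

theorem measurableSet_exitsBy (A T : Set (Fin d → ℤ)) (K : ℕ) :
    MeasurableSet (exitsBy A T K) := by
  have h : exitsBy A T K = ⋃ t ∈ Set.Iic K,
      (((fun ξ => ξ t) ⁻¹' Aᶜ ∩ ⋂ s ∈ Set.Iio t, (fun ξ => ξ s) ⁻¹' A) ∩ (fun ξ => ξ t) ⁻¹' T) := by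
    ext ξ
    simp only [exitsBy, IsLeast, lowerBounds, Set.mem_ofPred_eq, Set.mem_iUnion, Set.mem_inter_iff,
      Set.mem_preimage, Set.mem_iInter, Set.mem_Iio, Set.mem_Iic, Set.mem_compl_iff, exists_prop]
    refine exists_congr fun t => and_congr_right fun _ => and_congr_left fun _ =>
      and_congr_right fun _ => forall_congr' fun s => ?_
    rw [← not_lt, not_imp_not]
  have hm : ∀ (t : ℕ) (B : Set (Fin d → ℤ)),
      MeasurableSet ((fun ξ : ℕ → Fin d → ℤ => ξ t) ⁻¹' B) := fun t B =>
    measurable_pi_apply t (Set.to_countable B).measurableSet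
  rw [h]
  exact MeasurableSet.biUnion (Set.to_countable _) fun t _ =>
    ((hm t _).inter (MeasurableSet.biInter (Set.to_countable _) fun s _ => hm s _)).inter (hm t _)

theorem srwLaw_real_exitsThrough_le [NeZero d] {x : Fin d → ℤ} {A T : Set (Fin d → ℤ)} {p : ℝ}
    (h : ∀ K, (srwLaw x).real (exitsBy A T K) ≤ p) :
    (srwLaw x).real (exitsThrough A T) ≤ p := by
  have h0 : 0 ≤ p := measureReal_nonneg.trans (h 0)
  have hU : exitsThrough A T = ⋃ K, exitsBy A T K := by
    ext ξ
    simp only [exitsThrough, exitsBy, Set.mem_ofPred_eq, Set.mem_iUnion]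
    exact ⟨fun ⟨t, ht⟩ => ⟨t, t, le_rfl, ht⟩, fun ⟨_, t, _, ht⟩ => ⟨t, ht⟩⟩
  have hmono : Monotone (exitsBy A T) := fun K L hKL ξ ⟨t, ht, h⟩ => ⟨t, ht.trans hKL, h⟩
  refine ENNReal.toReal_le_of_le_ofReal h0 ?_
  rw [hU, hmono.measure_iUnion]
  exact iSup_le fun K => (ENNReal.le_ofReal_iff_toReal_le (measure_ne_top _ _) h0).2 (h K)

theorem srwLaw_ae_zero [NeZero d] (x : Fin d → ℤ) : ∀ᵐ ξ ∂srwLaw x, ξ 0 = x := by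
  refine (ae_map_iff (measurable_path x).aemeasurable
    (measurable_pi_apply 0 (measurableSet_singleton x))).2 (Filter.Eventually.of_forall fun ω => ?_)
  simp [path]

theorem srwLaw_real_exitsBy_eq_zero [NeZero d] {x : Fin d → ℤ} {A T : Set (Fin d → ℤ)}
    (hA : x ∉ A) (hT : x ∉ T) (K : ℕ) : (srwLaw x).real (exitsBy A T K) = 0 := by
  rw [measureReal_def, (ENNReal.toReal_eq_zero_iff _)]
  left
  refine measure_mono_null (fun ξ hξ => ?_) (ae_iff.1 (srwLaw_ae_zero x))
  intro h0
  obtain ⟨t, _, h1, h2⟩ := hξ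
  have : t = 0 := Nat.le_zero.1 (h1.2 (by simpa [h0] using hA))
  subst this
  exact hT (h0 ▸ h2)

theorem srwLaw_real_exitsBy_zero_eq_zero [NeZero d] {x : Fin d → ℤ} {A T : Set (Fin d → ℤ)}
    (hA : x ∈ A) : (srwLaw x).real (exitsBy A T 0) = 0 := by
  rw [measureReal_def, (ENNReal.toReal_eq_zero_iff _)]
  left
  refine measure_mono_null (fun ξ hξ => ?_) (ae_iff.1 (srwLaw_ae_zero x))
  intro h0
  obtain ⟨t, ht, h1, h2⟩ := hξ
  obtain rfl : t = 0 := Nat.le_zero.1 ht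
  exact h1.1 (h0.symm ▸ hA)

theorem srwLaw_real_exitsBy_succ_le [NeZero d] {x : Fin d → ℤ} {A T : Set (Fin d → ℤ)}
    (hA : x ∈ A) (K : ℕ) : (srwLaw x).real (exitsBy A T (K + 1)) ≤
      (∑ e : Fin d × Bool, (srwLaw (x + unitStep e)).real (exitsBy A T K)) / (2 * d) := by
  rw [← srwLaw_real_preimage_shift x (measurableSet_exitsBy A T K)]
  refine ENNReal.toReal_mono (measure_ne_top _ _) (measure_mono_ae ?_)
  filter_upwards [srwLaw_ae_zero x] with ξ h0
  rintro ⟨t, ht, h1, h2⟩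
  -- The exit time is positive because the walk starts in `A`.
  obtain _ | t := t
  · exact absurd hA (h0 ▸ h1.1)
  · exact ⟨t, Nat.le_of_succ_le_succ ht,
      ⟨h1.1, fun s hs => Nat.le_of_succ_le_succ (h1.2 (show s + 1 ∈ {s | ξ s ∉ A} from hs))⟩, h2⟩

/-! ### The heat kernel -/

theorem sum_unitStep {M : Type*} [AddCommMonoid M] (f : (Fin d → ℤ) → M) :
    ∑ e : Fin d × Bool, f (unitStep e) =
      ∑ i : Fin d, (f (Pi.single i 1) + f (-Pi.single i 1)) := by
  rw [Fintype.sum_prod_type]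
  exact Finset.sum_congr rfl fun i _ => by simp [unitStep]

/-- The character `exp (i w · θ)` of `ℤ^d`. -/
noncomputable def character (w : Fin d → ℤ) (θ : Fin d → ℝ) : ℂ :=
  ∏ i, Complex.exp (w i * θ i * Complex.I)

theorem norm_character (w : Fin d → ℤ) (θ : Fin d → ℝ) : ‖character w θ‖ = 1 := by
  rw [character, norm_prod]
  refine Finset.prod_eq_one fun i _ => ?_
  exact_mod_cast Complex.norm_exp_ofReal_mul_I (w i * θ i)

theorem character_add (v w : Fin d → ℤ) (θ : Fin d → ℝ) :
    character (v + w) θ = character v θ * character w θ := by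
  simp only [character, ← Finset.prod_mul_distrib, ← Complex.exp_add]
  refine Finset.prod_congr rfl fun i _ => ?_
  congr 1
  push_cast [Pi.add_apply]
  ring

theorem character_single (i : Fin d) (k : ℤ) (θ : Fin d → ℝ) :
    character (Pi.single i k) θ = Complex.exp (k * θ i * Complex.I) := by
  rw [character, Finset.prod_eq_single i]
  · simp
  · intro j _ hj
    simp [Pi.single_eq_of_ne hj]
  · simp

/-- The characteristic function of one step of the walk. -/
noncomputable def stepCharFun (θ : Fin d → ℝ) : ℝ := (∑ i, Real.cos (θ i)) / d

theorem sum_character_unitStep [NeZero d] (θ : Fin d → ℝ) :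
    (∑ e : Fin d × Bool, character (unitStep e) θ) / (2 * d) = stepCharFun θ := by
  have hd : (d : ℂ) ≠ 0 := by exact_mod_cast NeZero.ne d
  have h : ∀ i, character (Pi.single i 1) θ + character (-Pi.single i 1) θ =
      2 * Complex.cos (θ i) := by
    intro i
    rw [← Pi.single_neg, character_single, character_single, Complex.two_cos]
    push_cast
    simp
  rw [sum_unitStep fun w => character w θ]
  simp only [h, stepCharFun, ← Finset.mul_sum]
  push_cast
  field_simp

/-- `|cos a| ≤ 1 - sin² a / 2`, averaged over the coordinates. -/
theorem abs_stepCharFun_le [NeZero d] (θ : Fin d → ℝ) :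
    |stepCharFun θ| ≤ Real.exp (-∑ i, Real.sin (θ i) ^ 2 / (2 * d)) := by
  have hd : (0 : ℝ) < d := by exact_mod_cast NeZero.pos d
  have h1 : ∀ a : ℝ, |Real.cos a| ≤ 1 - Real.sin a ^ 2 / 2 := fun a => by
    have := Real.sin_sq_add_cos_sq a
    rw [← sq_abs (Real.cos a)] at this
    nlinarith [sq_nonneg (|Real.cos a| - 1)]
  calc |stepCharFun θ| = |∑ i, Real.cos (θ i)| / d := by rw [stepCharFun, abs_div, abs_of_pos hd]
    _ ≤ (∑ i, (1 - Real.sin (θ i) ^ 2 / 2)) / d := by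
        gcongr
        exact (Finset.abs_sum_le_sum_abs _ _).trans (Finset.sum_le_sum fun i _ => h1 _)
    _ = -(∑ i, Real.sin (θ i) ^ 2 / (2 * d)) + 1 := by
        rw [Finset.sum_sub_distrib, ← Finset.sum_div, ← Finset.sum_div]
        simp
        field_simp
        ring
    _ ≤ _ := Real.add_one_le_exp _

/-- Lebesgue measure on one period. The period is centred at `π / 2`, so that the two zeros `0`
and `π` of the sine lie in its interior. -/
noncomputable def period : Measure ℝ :=
  volume.restrict (Set.Ioc (-(Real.pi / 2)) (3 * Real.pi / 2))

instance : IsFiniteMeasure period := by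
  unfold period
  infer_instance

theorem integral_period {E : Type*} [NormedAddCommGroup E] [NormedSpace ℝ E] (f : ℝ → E) :
    ∫ a, f a ∂period = ∫ a in (-(Real.pi / 2))..(3 * Real.pi / 2), f a := by
  rw [intervalIntegral.integral_of_le (by linarith [Real.pi_pos]), period]

theorem integral_period_exp (k : ℤ) :
    ∫ a, Complex.exp (k * a * Complex.I) ∂period = if k = 0 then 2 * (Real.pi : ℂ) else 0 := by
  rw [integral_period]
  split_ifs with hk
  · subst hk
    simp
    ring
  · have hc : (k * Complex.I : ℂ) ≠ 0 := mul_ne_zero (by exact_mod_cast hk) Complex.I_ne_zero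
    have := integral_exp_mul_complex (a := -(Real.pi / 2)) (b := 3 * Real.pi / 2) hc
    simp only [show ∀ a : ℝ, (k * a * Complex.I : ℂ) = k * Complex.I * a from fun a => by ring]
    rw [this, show (k * Complex.I * ((3 * Real.pi / 2 : ℝ) : ℂ)) =
      k * Complex.I * ((-(Real.pi / 2) : ℝ) : ℂ) + k * (2 * Real.pi * Complex.I) by
        push_cast; ring, Complex.exp_add, Complex.exp_int_mul_two_pi_mul_I]
    simp

theorem integral_period_exp_sin_sq_le {b : ℝ} (hb : 0 < b) :
    ∫ a, Real.exp (-b * Real.sin a ^ 2) ∂period ≤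
      2 * Real.sqrt (Real.pi / (b * (2 / Real.pi) ^ 2)) := by
  have hpi := Real.pi_pos
  set f : ℝ → ℝ := fun a => Real.exp (-b * Real.sin a ^ 2)
  have hf : Continuous f := by fun_prop
  have hper : Function.Periodic f Real.pi := fun a => by simp [f, Real.sin_add_pi]
  have h1 : ∫ a, f a ∂period = 2 * ∫ a in (-(Real.pi / 2))..(Real.pi / 2), f a := by
    rw [integral_period, ← intervalIntegral.integral_add_adjacent_intervals
      (hf.intervalIntegrable _ (Real.pi / 2)) (hf.intervalIntegrable _ _)]
    have := hper.intervalIntegral_add_eq (Real.pi / 2) (-(Real.pi / 2))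
    rw [show Real.pi / 2 + Real.pi = 3 * Real.pi / 2 by ring,
      show -(Real.pi / 2) + Real.pi = Real.pi / 2 by ring] at this
    rw [this]
    ring
  have hc : 0 < b * (2 / Real.pi) ^ 2 := by positivity
  have hi := integrable_exp_neg_mul_sq hc
  rw [h1]
  gcongr
  rw [← integral_gaussian, intervalIntegral.integral_of_le (by linarith)]
  refine (setIntegral_mono_on hf.integrableOn_Ioc hi.integrableOn measurableSet_Ioc
    fun a ha => ?_).trans
    (setIntegral_le_integral hi (Filter.Eventually.of_forall fun a => (Real.exp_pos _).le))
  have h2 := Real.mul_abs_le_abs_sin (x := a) (abs_le.2 ⟨ha.1.le, ha.2⟩)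
  have h3 : (2 / Real.pi * |a|) ^ 2 ≤ |Real.sin a| ^ 2 := by gcongr
  rw [mul_pow, sq_abs, sq_abs] at h3
  refine Real.exp_le_exp.2 ?_
  nlinarith

/-- The heat kernel of the walk, as the Fourier integral of a power of the characteristic function:
the probability that a walk started at `w` is at the origin at time `t`. -/
noncomputable def heatKernel (t : ℕ) (w : Fin d → ℤ) : ℝ :=
  (∫ θ, (stepCharFun θ : ℂ) ^ t * character w θ ∂Measure.pi fun _ : Fin d => period).re /
    (2 * Real.pi) ^ d

theorem heatKernel_zero (w : Fin d → ℤ) : heatKernel 0 w = if w = 0 then 1 else 0 := by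
  have hpi := Real.pi_pos
  simp only [heatKernel, pow_zero, one_mul, character]
  rw [integral_fintype_prod_eq_prod (fun i (a : ℝ) => Complex.exp (w i * a * Complex.I))]
  simp only [integral_period_exp]
  split_ifs with hw
  · subst hw
    simp only [Pi.zero_apply, if_true, Finset.prod_const, Finset.card_univ, Fintype.card_fin]
    have : ((2 * (Real.pi : ℂ)) ^ d).re = (2 * Real.pi) ^ d := by
      rw [← Complex.ofReal_re ((2 * Real.pi) ^ d)]
      push_cast
      rfl
    rw [this, div_self (by positivity)]
  · obtain ⟨i, hi⟩ := Function.ne_iff.1 hw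
    rw [Finset.prod_eq_zero (Finset.mem_univ i) (if_neg hi)]
    simp

theorem integrable_heatKernel_integrand [NeZero d] (t : ℕ) (w : Fin d → ℤ) :
    Integrable (fun θ => (stepCharFun θ : ℂ) ^ t * character w θ)
      (Measure.pi fun _ : Fin d => period) := by
  refine Integrable.of_bound (Continuous.aestronglyMeasurable ?_) 1
    (Filter.Eventually.of_forall fun θ => ?_)
  · unfold stepCharFun character
    fun_prop
  · rw [norm_mul, norm_character, mul_one, norm_pow, Complex.norm_real, Real.norm_eq_abs]
    refine pow_le_one₀ (abs_nonneg _) ((abs_stepCharFun_le θ).trans (Real.exp_le_one_iff.2 ?_))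
    exact neg_nonpos.2 (Finset.sum_nonneg fun i _ => by positivity)

theorem heatKernel_succ [NeZero d] (t : ℕ) (w : Fin d → ℤ) :
    heatKernel (t + 1) w =
      (∑ e : Fin d × Bool, heatKernel t (w + unitStep e)) / (2 * d) := by
  simp only [heatKernel, ← Finset.sum_div, ← Complex.re_sum]
  rw [← integral_finsetSum _ fun e _ => integrable_heatKernel_integrand t _, div_right_comm]
  congr 1
  have h : ∀ θ : Fin d → ℝ, (stepCharFun θ : ℂ) ^ (t + 1) * character w θ =
      (∑ e : Fin d × Bool, (stepCharFun θ : ℂ) ^ t * character (w + unitStep e) θ) *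
        (((2 * d : ℝ)⁻¹ : ℝ) : ℂ) := by
    intro θ
    simp only [character_add, ← Finset.mul_sum]
    rw [pow_succ, ← sum_character_unitStep]
    push_cast
    ring
  simp only [h]
  rw [integral_mul_const, Complex.re_mul_ofReal, div_eq_mul_inv]

/-- The on-diagonal bound `O(t^(-d/2))` of the heat kernel. -/
theorem heatKernel_le [NeZero d] {t : ℕ} (ht : 0 < t) (w : Fin d → ℤ) :
    heatKernel t w ≤ Real.sqrt (Real.pi * d / (2 * t)) ^ d := by
  have hpi := Real.pi_pos
  have hd : (0 : ℝ) < d := by exact_mod_cast NeZero.pos d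
  have ht' : (0 : ℝ) < t := by exact_mod_cast ht
  set b : ℝ := t / (2 * d)
  have hb : 0 < b := by positivity
  have h1 : ∀ θ : Fin d → ℝ, ‖(stepCharFun θ : ℂ) ^ t * character w θ‖ ≤
      ∏ i, Real.exp (-b * Real.sin (θ i) ^ 2) := by
    intro θ
    rw [norm_mul, norm_character, mul_one, norm_pow, Complex.norm_real, Real.norm_eq_abs]
    refine (pow_le_pow_left₀ (abs_nonneg _) (abs_stepCharFun_le θ) t).trans_eq ?_
    rw [← Real.exp_nat_mul, ← Real.exp_sum, ← Finset.sum_neg_distrib, Finset.mul_sum]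
    congr 1
    exact Finset.sum_congr rfl fun i _ => by simp only [b]; ring
  have hint : Integrable (fun θ : Fin d → ℝ => ∏ i, Real.exp (-b * Real.sin (θ i) ^ 2))
      (Measure.pi fun _ : Fin d => period) := by
    refine Integrable.fintype_prod (f := fun _ a => Real.exp (-b * Real.sin a ^ 2)) fun _ =>
      Integrable.of_bound (Continuous.aestronglyMeasurable (by fun_prop)) 1
        (Filter.Eventually.of_forall fun a => ?_)
    rw [Real.norm_eq_abs, Real.abs_exp, Real.exp_le_one_iff]
    nlinarith [sq_nonneg (Real.sin a)]
  have h2 : 2 * Real.sqrt (Real.pi / (b * (2 / Real.pi) ^ 2)) =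
      2 * Real.pi * Real.sqrt (Real.pi * d / (2 * t)) := by
    rw [mul_assoc, ← Real.sqrt_sq hpi.le, ← Real.sqrt_mul (by positivity), Real.sqrt_sq hpi.le]
    congr 2
    simp only [b]
    field_simp
  rw [heatKernel, div_le_iff₀ (by positivity), ← mul_pow, mul_comm, ← h2]
  calc _ ≤ ‖∫ θ, (stepCharFun θ : ℂ) ^ t * character w θ ∂Measure.pi fun _ : Fin d => period‖ :=
        (Complex.re_le_norm _)
    _ ≤ ∫ θ : Fin d → ℝ, ∏ i, Real.exp (-b * Real.sin (θ i) ^ 2)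
          ∂Measure.pi fun _ : Fin d => period :=
        norm_integral_le_of_norm_le hint (Filter.Eventually.of_forall h1)
    _ = (∫ a, Real.exp (-b * Real.sin a ^ 2) ∂period) ^ d := by
        rw [integral_fintype_prod_eq_pow (fun a => Real.exp (-b * Real.sin a ^ 2)),
          Fintype.card_fin]
    _ ≤ _ := pow_le_pow_left₀ (integral_nonneg fun a => (Real.exp_pos _).le)
        (integral_period_exp_sin_sq_le hb) d

theorem heatKernel_nonneg [NeZero d] (t : ℕ) (w : Fin d → ℤ) : 0 ≤ heatKernel t w := by
  induction t generalizing w with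
  | zero => rw [heatKernel_zero]; split_ifs <;> norm_num
  | succ t ih =>
    rw [heatKernel_succ]
    exact div_nonneg (Finset.sum_nonneg fun e _ => ih _) (by positivity)

/-! ### Exiting a thin set close to the starting point -/

/-- The inclusion of `ℤ^d` in Euclidean space. -/
noncomputable def toEuclidean (y : Fin d → ℤ) : EuclideanSpace ℝ (Fin d) :=
  WithLp.toLp 2 fun i => (y i : ℝ)

theorem mem_ball_iff {y : Fin d → ℤ} {r : ℝ} : y ∈ ball d r ↔ ‖toEuclidean y‖ ≤ r := Iff.rfl

theorem toEuclidean_add (x y : Fin d → ℤ) :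
    toEuclidean (x + y) = toEuclidean x + toEuclidean y := by
  ext i; simp [toEuclidean]

theorem toEuclidean_neg (x : Fin d → ℤ) : toEuclidean (-x) = -toEuclidean x := by
  ext i; simp [toEuclidean]

theorem norm_toEuclidean_single_one (i : Fin d) :
    ‖toEuclidean (Pi.single i 1 : Fin d → ℤ)‖ = 1 := by
  have : toEuclidean (Pi.single i 1 : Fin d → ℤ) = EuclideanSpace.single i (1 : ℝ) := by
    ext j
    by_cases h : j = i
    · subst h; simp [toEuclidean]
    · simp [toEuclidean, h]
  rw [this]
  simp

theorem norm_toEuclidean_unitStep (e : Fin d × Bool) : ‖toEuclidean (unitStep e)‖ = 1 := by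
  unfold unitStep
  split_ifs
  · exact norm_toEuclidean_single_one _
  · rw [toEuclidean_neg, norm_neg, norm_toEuclidean_single_one]

/-- The squared distance to a point increases on average by `1` at each step. -/
theorem average_norm_sq [NeZero d] (w : Fin d → ℤ) (c : EuclideanSpace ℝ (Fin d)) :
    (∑ e : Fin d × Bool, ‖toEuclidean (w + unitStep e) - c‖ ^ 2) / (2 * d) =
      ‖toEuclidean w - c‖ ^ 2 + 1 := by
  have hd : (d : ℝ) ≠ 0 := by exact_mod_cast NeZero.ne d
  rw [sum_unitStep fun u => ‖toEuclidean (w + u) - c‖ ^ 2]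
  have h : ∀ i : Fin d, ‖toEuclidean (w + Pi.single i 1) - c‖ ^ 2 +
      ‖toEuclidean (w + -Pi.single i 1) - c‖ ^ 2 = 2 * (‖toEuclidean w - c‖ ^ 2 + 1) := by
    intro i
    have h1 := norm_toEuclidean_single_one i
    have := parallelogram_law_with_norm ℝ (toEuclidean w - c)
      (toEuclidean (Pi.single i 1 : Fin d → ℤ))
    rw [toEuclidean_add, toEuclidean_add, toEuclidean_neg, add_sub_right_comm, add_sub_right_comm,
      ← sub_eq_add_neg, this, h1]
    ring
  simp only [h, Finset.sum_const, Finset.card_univ, Fintype.card_fin, nsmul_eq_mul]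
  field_simp

/-- If `A` is covered by `S` within distance `R` of `z`, and `T` does not meet that ball, then a
walk that exits `A` through `T` must leave the ball by time `t` or be in `S` at time `t`.
The squared distance plus the time left, divided by `R²`, bounds the probability of the former. -/
theorem srwLaw_real_exitsBy_le [NeZero d] {A T : Set (Fin d → ℤ)} {S : Finset (Fin d → ℤ)}
    {c : EuclideanSpace ℝ (Fin d)} {R : ℝ} (hR : 0 < R)
    (hT : ∀ w, ‖toEuclidean w - c‖ < R → w ∉ T)
    (hA : ∀ w ∈ A, ‖toEuclidean w - c‖ < R → w ∈ S) (t K : ℕ) (w : Fin d → ℤ) :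
    (srwLaw w).real (exitsBy A T K) ≤
      (‖toEuclidean w - c‖ ^ 2 + t) / R ^ 2 + ∑ y ∈ S, heatKernel t (w - y) := by
  have hsum : ∀ (t : ℕ) (w : Fin d → ℤ), 0 ≤ ∑ y ∈ S, heatKernel t (w - y) := fun t w =>
    Finset.sum_nonneg fun y _ => heatKernel_nonneg t _
  have hsq : ∀ (t : ℕ) (w : Fin d → ℤ), 0 ≤ (‖toEuclidean w - c‖ ^ 2 + t) / R ^ 2 := fun t w => by
    positivity
  induction t generalizing K w with
  | zero =>
    rcases le_or_gt R ‖toEuclidean w - c‖ with hw | hw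
    · have : 1 ≤ (‖toEuclidean w - c‖ ^ 2 + (0 : ℕ)) / R ^ 2 := by
        rw [one_le_div (by positivity)]
        push_cast
        nlinarith
      linarith [hsum 0 w, measureReal_le_one (μ := srwLaw w) (s := exitsBy A T K)]
    · by_cases hwA : w ∈ A
      · have h := Finset.single_le_sum (f := fun y => heatKernel 0 (w - y))
          (fun y _ => heatKernel_nonneg 0 _) (hA w hwA hw)
        simp only [sub_self, heatKernel_zero (0 : Fin d → ℤ), if_true] at h
        linarith [hsq 0 w, measureReal_le_one (μ := srwLaw w) (s := exitsBy A T K)]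
      · rw [srwLaw_real_exitsBy_eq_zero hwA (hT w hw)]
        exact add_nonneg (hsq 0 w) (hsum 0 w)
  | succ t ih =>
    rcases le_or_gt R ‖toEuclidean w - c‖ with hw | hw
    · have : 1 ≤ (‖toEuclidean w - c‖ ^ 2 + (t + 1 : ℕ)) / R ^ 2 := by
        rw [one_le_div (by positivity)]
        have : (0 : ℝ) ≤ (t + 1 : ℕ) := Nat.cast_nonneg _
        nlinarith
      linarith [hsum (t + 1) w, measureReal_le_one (μ := srwLaw w) (s := exitsBy A T K)]
    · by_cases hwA : w ∈ A
      · cases K with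
        | zero =>
          rw [srwLaw_real_exitsBy_zero_eq_zero hwA]
          exact add_nonneg (hsq _ w) (hsum _ w)
        | succ K =>
          have hd : (0 : ℝ) < d := by exact_mod_cast NeZero.pos d
          refine (srwLaw_real_exitsBy_succ_le hwA K).trans ?_
          have h := div_le_div_of_nonneg_right (Finset.sum_le_sum
            fun e (_ : e ∈ (Finset.univ : Finset (Fin d × Bool))) => ih K (w + unitStep e))
            (show (0 : ℝ) ≤ 2 * d by positivity)
          refine h.trans_eq ?_
          rw [Finset.sum_add_distrib, add_div, ← Finset.sum_div, Finset.sum_add_distrib,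
            div_right_comm, add_div, average_norm_sq, Finset.sum_comm]
          congr 1
          · congr 1
            simp only [Finset.sum_const, Finset.card_univ, Fintype.card_prod, Fintype.card_fin,
              Fintype.card_bool, nsmul_eq_mul]
            push_cast
            field_simp
            ring
          · rw [Finset.sum_div]
            refine Finset.sum_congr rfl fun y _ => ?_
            rw [heatKernel_succ]
            simp only [add_sub_right_comm]
      · rw [srwLaw_real_exitsBy_eq_zero hwA (hT w hw)]
        exact add_nonneg (hsq _ w) (hsum _ w)

theorem ballCard_le {r : ℝ} (hr : 0 ≤ r) : (ballCard d r : ℝ) ≤ (2 * r + 1) ^ d := by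
  have hsub : ball d r ⊆ (Fintype.piFinset fun _ : Fin d => Finset.Icc (-⌊r⌋) ⌊r⌋ :
      Finset (Fin d → ℤ)) := by
    intro y hy
    refine Finset.mem_coe.2 (Fintype.mem_piFinset.2 fun i => Finset.mem_Icc.2 ?_)
    have h1 : |(y i : ℝ)| ≤ r := (PiLp.norm_apply_le (p := 2) (toEuclidean y) i).trans hy
    exact abs_le.1 (Int.le_floor.2 (by exact_mod_cast h1))
  have h := Set.ncard_le_ncard hsub (Finset.finite_toSet _)
  rw [Set.ncard_coe_finset, Fintype.card_piFinset_const, Int.card_Icc] at h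
  have h2 : (((⌊r⌋ + 1 - -⌊r⌋).toNat : ℕ) : ℝ) = 2 * ⌊r⌋ + 1 := by
    have h0 : 0 ≤ ⌊r⌋ := Int.floor_nonneg.2 hr
    have : (((⌊r⌋ + 1 - -⌊r⌋).toNat : ℕ) : ℤ) = 2 * ⌊r⌋ + 1 := by
      rw [Int.toNat_of_nonneg (by linarith)]; ring
    exact_mod_cast this
  calc (ballCard d r : ℝ) ≤ (((⌊r⌋ + 1 - -⌊r⌋).toNat ^ d : ℕ) : ℝ) := by exact_mod_cast h
    _ = (2 * ⌊r⌋ + 1) ^ d := by rw [Nat.cast_pow, h2]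
    _ ≤ (2 * r + 1) ^ d := by
        have h0 : (0 : ℝ) ≤ ⌊r⌋ := by exact_mod_cast Int.floor_nonneg.2 hr
        gcongr
        exact Int.floor_le r

/-- A maximum principle: a walk started inside the ball of radius `r` crosses the shell of width
`1` around that ball before leaving it, so bounds on the exit probability from the shell hold inside
as long as `T` is disjoint from the ball. -/
theorem srwLaw_real_exitsBy_le_of_shell [NeZero d] {A T : Set (Fin d → ℤ)} {p r : ℝ} (hp : 0 ≤ p)
    (hT : ∀ w, ‖toEuclidean w‖ < r → w ∉ T)
    (hshell : ∀ w, r ≤ ‖toEuclidean w‖ → ‖toEuclidean w‖ ≤ r + 1 →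
      ∀ K, (srwLaw w).real (exitsBy A T K) ≤ p)
    (K : ℕ) (w : Fin d → ℤ) (hw : ‖toEuclidean w‖ ≤ r + 1) :
    (srwLaw w).real (exitsBy A T K) ≤ p := by
  have hd : (0 : ℝ) < d := by exact_mod_cast NeZero.pos d
  induction K generalizing w with
  | zero =>
    rcases le_or_gt r ‖toEuclidean w‖ with hr | hr
    · exact hshell w hr hw 0
    by_cases hA : w ∈ A
    · rwa [srwLaw_real_exitsBy_zero_eq_zero hA]
    · rwa [srwLaw_real_exitsBy_eq_zero hA (hT w hr)]
  | succ K ih =>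
    rcases le_or_gt r ‖toEuclidean w‖ with hr | hr
    · exact hshell w hr hw _
    by_cases hA : w ∈ A
    · refine (srwLaw_real_exitsBy_succ_le hA K).trans ?_
      rw [div_le_iff₀ (by positivity)]
      refine (Finset.sum_le_card_nsmul _ _ p fun e _ => ih (w + unitStep e) ?_).trans_eq ?_
      · rw [toEuclidean_add]
        refine (norm_add_le _ _).trans ?_
        rw [norm_toEuclidean_unitStep]
        linarith
      · simp only [Finset.card_univ, Fintype.card_prod, Fintype.card_fin, Fintype.card_bool,
          nsmul_eq_mul]
        push_cast
        ring
    · rwa [srwLaw_real_exitsBy_eq_zero hA (hT w hr)]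

end ExitProb

theorem mainTheorem11 (d : ℕ) [NeZero d] (p : ℝ) (hp : 0 < p) :
    ∃ ε : ℝ, 0 < ε ∧ ∃ N : ℝ, 1 ≤ N ∧ ∀ n m : ℝ, N ≤ n → N ≤ m →
      ∀ x ∈ ExitProb.ball d m, ∀ S : Finset (Fin d → ℤ),
        (S : Set (Fin d → ℤ)) ⊆ ExitProb.ball d (m + n) →
        (S.card : ℝ) ≤ ε * (ExitProb.ballCard d n : ℝ) →
        (ExitProb.srwLaw x).real
          (ExitProb.exitsThrough ((S : Set (Fin d → ℤ)) ∪ ExitProb.ball d m)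
            (ExitProb.boundary (ExitProb.ball d (m + n)))) ≤ p := by
  have hpi := Real.pi_pos
  have hd : (0 : ℝ) < d := by exact_mod_cast NeZero.pos d
  -- `C / n` bounds the `d`-th root of the heat kernel at times at least `p n² / 64`.
  set C : ℝ := Real.sqrt (32 * Real.pi * d / p) with hC
  have hC0 : 0 < C := Real.sqrt_pos.2 (by positivity)
  -- `b_n ≤ (3 n)^d`, so this `ε` makes `ε b_n (C / n)^d` at most `p / 2`.
  refine ⟨p / 2 / (3 * C) ^ d, by positivity, 4 + 32 / p, ?_, ?_⟩
  · have : 0 < 32 / p := by positivity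
    linarith
  intro n m hn hm x hx S _ hScard
  have h32 : 0 < 32 / p := by positivity
  have hn4 : 4 ≤ n := by linarith
  have hm0 : 0 < m := by linarith
  -- The number of steps after which the walk is unlikely to be in `S`.
  set t : ℕ := ⌊p * n ^ 2 / 32⌋₊ with ht
  have hone : 1 ≤ p * n ^ 2 / 32 := by
    have h1 : 32 / p ≤ n ^ 2 := by nlinarith
    rw [div_le_iff₀ hp] at h1
    linarith
  have ht_le : (t : ℝ) ≤ p * n ^ 2 / 32 := Nat.floor_le (by positivity)
  have ht_ge : p * n ^ 2 / 64 ≤ t := by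
    have h1 : (1 : ℝ) ≤ t := by exact_mod_cast Nat.le_floor (by exact_mod_cast hone)
    have h2 := Nat.lt_floor_add_one (p * n ^ 2 / 32)
    rw [← ht] at h2
    linarith
  have ht_pos : 0 < t := by
    have : (0 : ℝ) < t := lt_of_lt_of_le (by positivity) ht_ge
    exact_mod_cast this
  have hheat : ∀ w : Fin d → ℤ, ExitProb.heatKernel t w ≤ (C / n) ^ d := by
    intro w
    refine (ExitProb.heatKernel_le ht_pos w).trans (pow_le_pow_left₀ (Real.sqrt_nonneg _) ?_ d)
    rw [Real.sqrt_le_left (by positivity), div_pow, hC, Real.sq_sqrt (by positivity), div_div,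
      div_le_div_iff₀ (by positivity) (by positivity)]
    have : 0 < Real.pi * d := by positivity
    nlinarith
  have hsumle : ∀ w : Fin d → ℤ, ∑ y ∈ S, ExitProb.heatKernel t (w - y) ≤ p / 2 := by
    intro w
    have hcard : (S.card : ℝ) ≤ p / 2 / (3 * C) ^ d * (3 * n) ^ d := by
      refine hScard.trans ?_
      gcongr
      refine (ExitProb.ballCard_le (by linarith)).trans ?_
      gcongr
      linarith
    calc ∑ y ∈ S, ExitProb.heatKernel t (w - y) ≤ S.card * (C / n) ^ d := by
          simpa using Finset.sum_le_card_nsmul S _ _ fun y _ => hheat (w - y)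
      _ ≤ p / 2 / (3 * C) ^ d * (3 * n) ^ d * (C / n) ^ d := by gcongr
      _ = p / 2 := by
          rw [mul_assoc, ← mul_pow, show 3 * n * (C / n) = 3 * C by field_simp]
          field_simp
  have hbdry : ∀ w, ‖ExitProb.toEuclidean w‖ ≤ m + n →
      w ∉ ExitProb.boundary (ExitProb.ball d (m + n)) := fun w hw h => h.1 hw
  refine ExitProb.srwLaw_real_exitsThrough_le fun K =>
    ExitProb.srwLaw_real_exitsBy_le_of_shell (r := m + n / 2) hp.le
      (fun w hw => hbdry w (by linarith)) (fun z hz1 hz2 L => ?_) K x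
      ((ExitProb.mem_ball_iff.1 hx).trans (by linarith))
  -- From a point `z` of the shell, the ball of radius `n / 2 - 1` around `z` meets neither
  -- `B[m]` nor the complement of `B[m + n]`.
  have h := ExitProb.srwLaw_real_exitsBy_le (A := (S : Set (Fin d → ℤ)) ∪ ExitProb.ball d m)
    (T := ExitProb.boundary (ExitProb.ball d (m + n))) (S := S) (c := ExitProb.toEuclidean z)
    (R := n / 2 - 1) (by linarith) (fun w hw => hbdry w ?_) (fun w hwA hw => ?_) t L z
  · refine h.trans ?_
    rw [sub_self, norm_zero]
    have h1 : ((0 : ℝ) ^ 2 + t) / (n / 2 - 1) ^ 2 ≤ p / 2 := by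
      rw [div_le_iff₀ (pow_pos (by linarith) 2)]
      have : (n / 4) ^ 2 ≤ (n / 2 - 1) ^ 2 := pow_le_pow_left₀ (by linarith) (by linarith) 2
      nlinarith
    linarith [hsumle z]
  · have := norm_le_norm_add_norm_sub' (ExitProb.toEuclidean w) (ExitProb.toEuclidean z)
    linarith
  · refine hwA.resolve_right fun hwm => ?_
    have h1 := norm_le_norm_add_norm_sub (ExitProb.toEuclidean w) (ExitProb.toEuclidean z)
    have h2 := ExitProb.mem_ball_iff.1 hwm
    linarith
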